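/- Let $d$ be an odd integer with $5\le d\le 15$, or $d\in\{21,35\}$. Let $$f(x_1,x_2,x_3)=\sum_{\sigma\in\mathfrak S_3}a_\sigma\,x_{\sigma(1)}x_{\sigma(2)}x_{\sigma(3)},\qquad a_\sigma\in\mathbb C,$$ be a multilinear polynomial of degree three in the free algebra $\mathbb C\langle x_1,x_2,x_3\rangle$, let $a_{pqr}$ denote the coefficient of $x_px_qx_r$ in $f$, and let $\operatorname{Im} f=\{f(X_1,X_2,X_3): X_1,X_2,X_3\in M_d(\mathbb C)\}$. (1) If $a_{123}+a_{132}+a_{213}+a_{231}+a_{312}+a_{321}=0$ and $a_{123}+a_{231}+a_{312}\neq 0$, then $\operatorname{Im} f=M_d(\mathbb C)$. (2) More generally, if $f$ is not a sum of commutators $pq-qp$ with $p,q\in\mathbb C\langle x_1,x_2,x_3\rangle$, then $\operatorname{Im} f=M_d(\mathbb C)$. -/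

import Mathlib

/-- The multilinear noncommutative polynomial of degree three with coefficients `a`,
`f(x₀, x₁, x₂) = ∑_{σ ∈ S₃} a_σ x_{σ(0)} x_{σ(1)} x_{σ(2)}`, in the free algebra `ℂ⟨x₀, x₁, x₂⟩`.
The letters are indexed by `0, 1, 2` instead of `1, 2, 3`. -/
noncomputable def multilinearPoly (a : Equiv.Perm (Fin 3) → ℂ) : FreeAlgebra ℂ (Fin 3) :=
  ∑ σ : Equiv.Perm (Fin 3),
    a σ • (FreeAlgebra.ι ℂ (σ 0) * FreeAlgebra.ι ℂ (σ 1) * FreeAlgebra.ι ℂ (σ 2))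

/-- `f` is a (finite) sum of commutators `p q - q p` of elements of the free algebra. -/
def IsSumOfCommutators (f : FreeAlgebra ℂ (Fin 3)) : Prop :=
  f ∈ AddSubmonoid.closure {g : FreeAlgebra ℂ (Fin 3) | ∃ p q, g = p * q - q * p}

/-- The image of `f` on `M_d(ℂ)`: the set of all its values at triples of `d × d` matrices. -/
def matrixImage (d : ℕ) (f : FreeAlgebra ℂ (Fin 3)) : Set (Matrix (Fin d) (Fin d) ℂ) :=
  Set.range fun X : Fin 3 → Matrix (Fin d) (Fin d) ℂ => FreeAlgebra.lift ℂ X f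

/-- The sum of all six coefficients of `f`. -/
def coeffSum (a : Equiv.Perm (Fin 3) → ℂ) : ℂ :=
  ∑ σ : Equiv.Perm (Fin 3), a σ

/-- `a₁₂₃ + a₂₃₁ + a₃₁₂`, where `a_{pqr}` is the coefficient of `x_p x_q x_r`. Here `finRotate 3`
is the permutation `i ↦ i + 1` of `{0, 1, 2}`, which is `231` in one-line notation. -/
def cyclicCoeffSum (a : Equiv.Perm (Fin 3) → ℂ) : ℂ :=
  a 1 + a (finRotate 3) + a (finRotate 3)⁻¹

/-!
If the sum `s` of the coefficients of `f` is nonzero, then `f(1, 1, A / s) = A`. If `s = 0` and the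
cyclic sum `c` vanishes, then `f` is a sum of commutators, because monomials differing by a cyclic
rotation differ by a commutator. There remains the case `s = 0`, `c ≠ 0`, in which `f` takes every
value on matrices of any size at least two; no condition on the parity of the size is needed.

Scalar matrices are obtained from the clock and shift matrices `U`, `V`, with `VU = ζ UV`: the value
of `f` at `(U, V, (UV)⁻¹)` is `c (1 - ζ)` (`exists_cubicValue_eq_smul_one`).

For other matrices, setting one variable to `1` leaves a multiple of a commutator of the other two.
The three multiples have alternating sum `± c`, so one of them is nonzero; name the variables so that
it belongs to `X`. Take for `X` a diagonal matrix differing from `1` only in its corner entry, and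
for `Y` a diagonal matrix with distinct entries plus a first row. In the complementary block,
`f(X, Y, Z)` is then a multiple of `[Y, Z]`, which accounts for all entries off the diagonal, plus a
matrix of rank one, and the whole equation `f(X, Y, Z) = B` is triangular in the off-diagonal
entries of `Z` (`exists_cubicValue_eq_of_diag`). The only constraint is on the diagonal of `B`: the
corner is prescribed, and the rest is the diagonal of a multiple of `u ρ`, where `u` is the first
column of `B` below the corner and `ρ` is some row vector with `ρ u = 1`. Every matrix which is not
scalar is similar to such a `B` (`exists_isConj_diag_eq_mul`), essentially because every matrix of
trace zero is similar to one with zero diagonal (`exists_isConj_diag_eq_zero`).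
-/

open Matrix

/-- The value at `(X, Y, Z)` of a multilinear polynomial of degree three. The coefficients
`p₁, p₂, p₃` belong to `XYZ, YXZ, YZX`, the monomials in which `Y` precedes `Z`, and `q₁, q₂, q₃`
to `XZY, ZXY, ZYX`; the index is the position of `X` in the monomial. -/
def cubicValue {R : Type*} [Ring R] [Algebra ℂ R] (p₁ p₂ p₃ q₁ q₂ q₃ : ℂ) (X Y Z : R) : R :=
  p₁ • (X * Y * Z) + p₂ • (Y * X * Z) + p₃ • (Y * Z * X) +
    q₁ • (X * Z * Y) + q₂ • (Z * X * Y) + q₃ • (Z * Y * X)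

/-! ### Similarity of matrices -/

theorem trace_eq_of_isConj {n : Type*} [Fintype n] [DecidableEq n] {A B : Matrix n n ℂ}
    (h : IsConj A B) : B.trace = A.trace := by
  obtain ⟨P, hP⟩ := h
  rw [(Units.eq_mul_inv_iff_mul_eq P).2 hP.eq.symm, trace_mul_comm, ← mul_assoc]
  simp

theorem isConj_submatrix {n : Type*} [Fintype n] [DecidableEq n] (A : Matrix n n ℂ)
    (e : Equiv.Perm n) : IsConj A (A.submatrix e e) := by
  have h1 : e.permMatrix ℂ * e⁻¹.permMatrix ℂ = 1 := by
    rw [← Matrix.permMatrix_mul]; simp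
  have h2 : e⁻¹.permMatrix ℂ * e.permMatrix ℂ = 1 := by
    rw [← Matrix.permMatrix_mul]; simp
  refine ⟨⟨e.permMatrix ℂ, e⁻¹.permMatrix ℂ, h1, h2⟩, ?_⟩
  change e.permMatrix ℂ * A = A.submatrix e e * e.permMatrix ℂ
  rw [PEquiv.toMatrix_toPEquiv_mul, PEquiv.mul_toMatrix_toPEquiv, submatrix_submatrix]
  simp [Function.comp_def]
  rfl

/-- Conjugation by the transvection `1 + s E_{ij}`. -/
theorem isConj_transvection {n : Type*} [Fintype n] [DecidableEq n] (A : Matrix n n ℂ) {i j : n}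
    (hij : i ≠ j) (s : ℂ) : IsConj A (transvection i j s * A * transvection i j (-s)) := by
  have h (t : ℂ) : transvection i j t * transvection i j (-t) = 1 := by
    rw [transvection_mul_transvection_same _ _ hij]; simp
  have h' : transvection i j (-s) * transvection i j s = 1 := by simpa using h (-s)
  refine ⟨⟨_, _, h s, h'⟩, ?_⟩
  change transvection i j s * A = transvection i j s * A * transvection i j (-s) *
    transvection i j s
  rw [mul_assoc _ _ (transvection i j s), h', mul_one]

/-- A matrix which is not scalar is similar to one with a nonzero entry off the diagonal: a
transvection produces one from two distinct diagonal entries. -/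
theorem exists_isConj_offDiag_ne_zero {n : Type*} [Fintype n] [DecidableEq n] {A : Matrix n n ℂ}
    (hA : ∀ t : ℂ, A ≠ t • 1) : ∃ B, IsConj A B ∧ ∃ i j, i ≠ j ∧ B i j ≠ 0 := by
  by_contra! H
  have hd : ∀ i j, i ≠ j → A i j = 0 := H A (IsConj.refl A)
  have he : ∀ i j, A i i = A j j := by
    intro i j
    by_cases hij : i = j
    · rw [hij]
    have h := H _ (isConj_transvection A hij 1) i j hij
    simp only [mul_transvection_apply_same, transvection_mul_apply_same, hd i j hij,
      hd j i (Ne.symm hij)] at h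
    linear_combination -h
  rcases isEmpty_or_nonempty n with hn | ⟨⟨k⟩⟩
  · exact hA 0 (Subsingleton.elim _ _)
  · refine hA (A k k) ?_
    ext i j
    by_cases hij : i = j
    · simp [hij, he j k]
    · simp [hij, hd i j hij]

/-- A matrix which is not scalar is similar to one with a prescribed corner entry and with first
column not proportional to the first basis vector: once an off-diagonal entry in the first column is
nonzero, a transvection adjusts the corner without changing that column below the corner. -/
theorem exists_isConj_corner {n : ℕ} {A : Matrix (Fin (n + 1)) (Fin (n + 1)) ℂ}
    (hA : ∀ t : ℂ, A ≠ t • 1) (a : ℂ) :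
    ∃ B, IsConj A B ∧ B 0 0 = a ∧ ∃ k : Fin n, B k.succ 0 ≠ 0 := by
  obtain ⟨B, hB, i, j, hij, hne⟩ := exists_isConj_offDiag_ne_zero hA
  let e : Equiv.Perm (Fin (n + 1)) := Equiv.swap 0 j
  obtain ⟨k, hk⟩ : ∃ k : Fin n, k.succ = e.symm i := by
    refine Fin.exists_succ_eq.2 fun h => hij ?_
    rw [Equiv.symm_apply_eq] at h
    simpa [e] using h
  have hC : (B.submatrix e e) k.succ 0 ≠ 0 := by simpa [hk, e] using hne
  set C := B.submatrix e e
  have h0 : (0 : Fin (n + 1)) ≠ k.succ := (Fin.succ_ne_zero k).symm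
  refine ⟨_, (hB.trans (isConj_submatrix B e)).trans
    (isConj_transvection C h0 ((a - C 0 0) / C k.succ 0)), ?_, k, ?_⟩
  · rw [mul_transvection_apply_of_ne _ _ _ _ h0, transvection_mul_apply_same]
    field_simp
    ring
  · rw [mul_transvection_apply_of_ne _ _ _ _ h0, transvection_mul_apply_of_ne _ _ _ _ h0.symm]
    exact hC

/-- The block diagonal matrix with blocks `1` and `Q`. -/
def oneBlock {n : ℕ} (Q : Matrix (Fin n) (Fin n) ℂ) : Matrix (Fin (n + 1)) (Fin (n + 1)) ℂ :=
  of (Fin.cons (Fin.cons 1 0) fun i => Fin.cons 0 (Q i))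

section oneBlock

variable {n : ℕ} (Q : Matrix (Fin n) (Fin n) ℂ)

@[simp] theorem oneBlock_zero_zero : oneBlock Q 0 0 = 1 := rfl

@[simp] theorem oneBlock_zero_succ (j : Fin n) : oneBlock Q 0 j.succ = 0 := rfl

@[simp] theorem oneBlock_succ_zero (i : Fin n) : oneBlock Q i.succ 0 = 0 := rfl

@[simp] theorem oneBlock_succ_succ (i j : Fin n) : oneBlock Q i.succ j.succ = Q i j := rfl

theorem oneBlock_mul (R : Matrix (Fin n) (Fin n) ℂ) :
    oneBlock Q * oneBlock R = oneBlock (Q * R) := by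
  ext i j
  refine Fin.cases ?_ (fun i => ?_) i <;> refine Fin.cases ?_ (fun j => ?_) j <;>
    simp [Matrix.mul_apply, Fin.sum_univ_succ]

theorem oneBlock_one : oneBlock (1 : Matrix (Fin n) (Fin n) ℂ) = 1 := by
  ext i j
  refine Fin.cases ?_ (fun i => ?_) i <;> refine Fin.cases ?_ (fun j => ?_) j <;>
    simp [Matrix.one_apply, Fin.succ_ne_zero, (Fin.succ_ne_zero _).symm]

end oneBlock

/-- Conjugation by a block diagonal matrix with blocks `1` and `Q`. -/
theorem exists_isConj_oneBlock {n : ℕ} (A : Matrix (Fin (n + 1)) (Fin (n + 1)) ℂ)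
    (Q : (Matrix (Fin n) (Fin n) ℂ)ˣ) :
    ∃ B, IsConj A B ∧ B 0 0 = A 0 0 ∧ (∀ i, B i.succ 0 = (Q.1 *ᵥ fun j => A j.succ 0) i) ∧
      B.submatrix Fin.succ Fin.succ = Q.1 * A.submatrix Fin.succ Fin.succ * Q⁻¹.1 := by
  have h1 : oneBlock Q.1 * oneBlock Q⁻¹.1 = 1 := by
    rw [oneBlock_mul, Units.mul_inv, oneBlock_one]
  have h2 : oneBlock Q⁻¹.1 * oneBlock Q.1 = 1 := by
    rw [oneBlock_mul, Units.inv_mul, oneBlock_one]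
  refine ⟨oneBlock Q.1 * A * oneBlock Q⁻¹.1, ⟨⟨_, _, h1, h2⟩, ?_⟩, ?_, fun i => ?_, ?_⟩
  · change oneBlock Q.1 * A = oneBlock Q.1 * A * oneBlock Q⁻¹.1 * oneBlock Q.1
    rw [mul_assoc _ _ (oneBlock Q.1), h2, mul_one]
  · simp [Matrix.mul_apply, Fin.sum_univ_succ]
  · simp [Matrix.mul_apply, Fin.sum_univ_succ, mulVec, dotProduct]
  · ext i j
    simp [Matrix.mul_apply, Fin.sum_univ_succ]

/-- A matrix of trace zero is similar to one with zero diagonal: make the corner zero, and treat the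
complementary block, again of trace zero, by induction. -/
theorem exists_isConj_diag_eq_zero {n : ℕ} (A : Matrix (Fin n) (Fin n) ℂ) (hA : A.trace = 0) :
    ∃ B, IsConj A B ∧ ∀ i, B i i = 0 := by
  induction n with
  | zero => exact ⟨A, IsConj.refl A, fun i => i.elim0⟩
  | succ n ih =>
    by_cases hs : ∃ t : ℂ, A = t • 1
    · obtain ⟨t, rfl⟩ := hs
      have ht : t = 0 := by
        have : t * ((n : ℂ) + 1) = 0 := by simpa using hA
        exact (mul_eq_zero.1 this).resolve_right (Nat.cast_add_one_ne_zero n)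
      exact ⟨_, IsConj.refl _, fun i => by simp [ht]⟩
    · push Not at hs
      obtain ⟨B, hAB, hB, -⟩ := exists_isConj_corner hs 0
      have htr : (B.submatrix Fin.succ Fin.succ).trace = 0 := by
        have h : B.trace = 0 := (trace_eq_of_isConj hAB).trans hA
        simpa [trace, Fin.sum_univ_succ, hB] using h
      obtain ⟨C, ⟨Q, hQ⟩, hC⟩ := ih _ htr
      obtain ⟨E, hBE, hE0, -, hE⟩ := exists_isConj_oneBlock B Q
      refine ⟨E, hAB.trans hBE, Fin.cases (hE0.trans hB) fun i => ?_⟩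
      rw [← hC i, (Units.eq_mul_inv_iff_mul_eq Q).2 hQ.eq.symm, ← hE]
      rfl

/-- Every matrix which is not scalar is similar to a matrix whose corner entry is a prescribed `a`
and whose other diagonal entries are those of a multiple of `u ρ`, where `u` is the first column
below the corner and `ρ` is a row vector with `ρ u = 1`. Indeed, the complementary block minus
`b u ρ` has trace zero, so a change of basis in that block makes its diagonal zero. -/
theorem exists_isConj_diag_eq_mul {n : ℕ} {A : Matrix (Fin (n + 1)) (Fin (n + 1)) ℂ}
    (hA : ∀ t : ℂ, A ≠ t • 1) {a b : ℂ} (hab : a + b = A.trace) :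
    ∃ (B : Matrix (Fin (n + 1)) (Fin (n + 1)) ℂ) (ρ : Fin n → ℂ), IsConj A B ∧ B 0 0 = a ∧
      ∑ j, B j.succ 0 * ρ j = 1 ∧ ∀ j, B j.succ j.succ = b * (B j.succ 0 * ρ j) := by
  obtain ⟨B, hAB, hB, k, hk⟩ := exists_isConj_corner hA a
  set u : Fin n → ℂ := fun j => B j.succ 0 with hu
  set ρ : Fin n → ℂ := Pi.single k (u k)⁻¹ with hρ
  have hρu : ρ ⬝ᵥ u = 1 := by
    rw [hρ, single_dotProduct]
    exact inv_mul_cancel₀ hk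
  set S := B.submatrix Fin.succ Fin.succ with hS
  have htr : (S - b • vecMulVec u ρ).trace = 0 := by
    have h := trace_eq_of_isConj hAB
    have h2 : B.trace = a + S.trace := by
      rw [trace, Fin.sum_univ_succ, diag_apply, hB]
      rfl
    rw [trace_sub, trace_smul, trace_vecMulVec, dotProduct_comm, hρu, smul_eq_mul]
    linear_combination h - h2 - hab
  obtain ⟨C, ⟨Q, hQ⟩, hC⟩ := exists_isConj_diag_eq_zero _ htr
  obtain ⟨E, hBE, hE0, hEc, hE⟩ := exists_isConj_oneBlock B Q
  refine ⟨E, ρ ᵥ* Q⁻¹.1, hAB.trans hBE, hE0.trans hB, ?_, fun j => ?_⟩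
  · simp only [hEc]
    change (Q.1 *ᵥ u) ⬝ᵥ (ρ ᵥ* Q⁻¹.1) = 1
    rw [dotProduct_comm, ← dotProduct_mulVec, mulVec_mulVec, Units.inv_mul, one_mulVec, hρu]
  · have h1 := (Units.eq_mul_inv_iff_mul_eq Q).2 hQ.eq.symm
    have h2 : E.submatrix Fin.succ Fin.succ = C + b • vecMulVec (Q.1 *ᵥ u) (ρ ᵥ* Q⁻¹.1) := by
      rw [hE, h1, mul_sub, sub_mul, mul_smul_comm, smul_mul_assoc, mul_vecMulVec, vecMulVec_mul]
      simp [hS]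
    have h3 := congrFun (congrFun h2 j) j
    rw [hEc]
    simpa [hC, vecMulVec_apply] using h3

/-! ### Solving for a prescribed value -/

theorem cubicValue_conj {R : Type*} [Ring R] [Algebra ℂ R] (p₁ p₂ p₃ q₁ q₂ q₃ : ℂ) (P : Rˣ)
    (X Y Z : R) :
    cubicValue p₁ p₂ p₃ q₁ q₂ q₃ (P⁻¹.1 * X * P) (P⁻¹.1 * Y * P) (P⁻¹.1 * Z * P) =
      P⁻¹.1 * cubicValue p₁ p₂ p₃ q₁ q₂ q₃ X Y Z * P := by
  simp [cubicValue, mul_add, add_mul, mul_assoc]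

theorem cubicValue_apply {n : Type*} [Fintype n] [DecidableEq n] (p₁ p₂ p₃ q₁ q₂ q₃ : ℂ)
    (x : n → ℂ) (Y Z : Matrix n n ℂ) (i j : n) :
    cubicValue p₁ p₂ p₃ q₁ q₂ q₃ (diagonal x) Y Z i j =
      ∑ k, ((p₁ * x i + p₂ * x k + p₃ * x j) * (Y i k * Z k j) +
        (q₁ * x i + q₂ * x k + q₃ * x j) * (Z i k * Y k j)) := by
  have h1 (M N : Matrix n n ℂ) : (M * diagonal x * N) i j = ∑ k, M i k * x k * N k j := by
    rw [Matrix.mul_apply]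
    simp only [mul_diagonal]
  simp only [cubicValue, Matrix.add_apply, Matrix.smul_apply, smul_eq_mul, h1, mul_diagonal,
    mul_assoc (diagonal x), diagonal_mul]
  simp only [Matrix.mul_apply, Finset.mul_sum, Finset.sum_mul, ← Finset.sum_add_distrib]
  exact Finset.sum_congr rfl fun k _ => by ring

/-- Let `X = diag(1 + τ, 1, …, 1)` and let `Y` be `diag(0, 1, …, n)` plus a row vector in its first
row. The equation `f(X, Y, Z) = B` is then triangular in the off-diagonal entries of `Z`, which can
be solved for in turn: first column, lower right block, first row. The diagonal of `B` only imposes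
the conditions `h00` and `hdiag`, which the choice of the row vector in `Y` fulfils. -/
theorem exists_cubicValue_eq_of_diag {n : ℕ} {p₁ p₂ p₃ q₁ q₂ q₃ : ℂ}
    (hsum : p₁ + p₂ + p₃ + q₁ + q₂ + q₃ = 0) (hp : p₁ + p₂ + p₃ ≠ 0) {τ : ℂ}
    (h1 : p₁ + p₂ + p₃ + p₃ * τ ≠ 0) (h2 : q₁ + q₂ + q₃ + q₁ * τ ≠ 0)
    (B : Matrix (Fin (n + 1)) (Fin (n + 1)) ℂ) (r : Fin n → ℂ)
    (h00 : B 0 0 = ((p₁ + p₃) * (1 + τ) + p₂) * ∑ j, B j.succ 0 * r j)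
    (hdiag : ∀ j, B j.succ j.succ = (q₁ + q₃ + q₂ * (1 + τ)) * (B j.succ 0 * r j)) :
    ∃ X Y Z, cubicValue p₁ p₂ p₃ q₁ q₂ q₃ X Y Z = B := by
  have hd (i : Fin n) : (i : ℂ) + 1 ≠ 0 := Nat.cast_add_one_ne_zero _
  have hdd (i j : Fin n) (hij : i ≠ j) : (i : ℂ) - (j : ℂ) ≠ 0 := by
    rw [sub_ne_zero]
    exact fun h => hij (Fin.ext (by exact_mod_cast h))
  -- `z`, `W` and `s` are the first column, the lower right block and the first row of `Z`
  let y : Fin n → ℂ := fun j => r j * (((j : ℂ) + 1) * (p₁ + p₂ + p₃ + p₃ * τ))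
  let z : Fin n → ℂ := fun i => B i.succ 0 / (((i : ℂ) + 1) * (p₁ + p₂ + p₃ + p₃ * τ))
  have hzy (j : Fin n) : z j * y j = B j.succ 0 * r j := by
    have := hd j
    simp only [z, y]
    field_simp
  let W : Matrix (Fin n) (Fin n) ℂ := of fun i j => if i = j then 0 else
    (B i.succ j.succ - (q₁ + q₃ + q₂ * (1 + τ)) * (z i * y j)) /
      ((p₁ + p₂ + p₃) * ((i : ℂ) - (j : ℂ)))
  let s : Fin n → ℂ := fun j =>
    (B 0 j.succ - (p₁ * (1 + τ) + p₂ + p₃) * ∑ k, y k * W k j) /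
      (((j : ℂ) + 1) * (q₁ + q₂ + q₃ + q₁ * τ))
  let x : Fin (n + 1) → ℂ := Fin.cons (1 + τ) fun _ => 1
  let Y : Matrix (Fin (n + 1)) (Fin (n + 1)) ℂ :=
    of (Fin.cons (Fin.cons 0 y) fun i => Fin.cons 0 (diagonal (fun i : Fin n => (i : ℂ) + 1) i))
  let Z : Matrix (Fin (n + 1)) (Fin (n + 1)) ℂ :=
    of (Fin.cons (Fin.cons 0 s) fun i => Fin.cons (z i) (W i))
  refine ⟨diagonal x, Y, Z, ?_⟩
  ext i j
  have hq : q₁ + q₂ + q₃ = -(p₁ + p₂ + p₃) := by linear_combination hsum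
  rw [cubicValue_apply, Fin.sum_univ_succ]
  refine Fin.cases ?_ (fun i => ?_) i <;> refine Fin.cases ?_ (fun j => ?_) j
  · simp only [x, Y, Z, of_apply, Fin.cons_zero, Fin.cons_succ]
    rw [h00, Finset.mul_sum]
    simp only [mul_zero, add_zero, zero_add]
    exact Finset.sum_congr rfl fun k _ => by rw [← hzy]; ring
  · simp only [x, Y, Z, of_apply, Fin.cons_zero, Fin.cons_succ, Finset.sum_add_distrib,
      diagonal_apply, mul_ite, mul_zero, Finset.sum_ite_eq', Finset.mem_univ, if_true]
    rw [← Finset.mul_sum]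
    have hs : s j * (((j : ℂ) + 1) * (q₁ + q₂ + q₃ + q₁ * τ)) =
        B 0 j.succ - (p₁ * (1 + τ) + p₂ + p₃) * ∑ k, y k * W k j :=
      div_mul_cancel₀ _ (mul_ne_zero (hd j) h2)
    linear_combination hs
  · simp only [x, Y, Z, of_apply, Fin.cons_zero, Fin.cons_succ, Finset.sum_add_distrib,
      diagonal_apply, mul_ite, ite_mul, mul_zero, zero_mul, Finset.sum_ite_eq, Finset.mem_univ,
      if_true]
    have hz : z i * (((i : ℂ) + 1) * (p₁ + p₂ + p₃ + p₃ * τ)) = B i.succ 0 :=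
      div_mul_cancel₀ _ (mul_ne_zero (hd i) h1)
    rw [Finset.sum_const_zero]
    linear_combination hz
  · simp only [x, Y, Z, of_apply, Fin.cons_zero, Fin.cons_succ, Finset.sum_add_distrib,
      diagonal_apply, mul_ite, ite_mul, mul_zero, zero_mul, Finset.sum_ite_eq, Finset.sum_ite_eq',
      Finset.mem_univ, if_true]
    by_cases hij : i = j
    · subst hij
      rw [hdiag, ← hzy]
      simp only [W, of_apply, if_true]
      ring
    · have hW : W i j * ((p₁ + p₂ + p₃) * ((i : ℂ) - (j : ℂ))) =
          B i.succ j.succ - (q₁ + q₃ + q₂ * (1 + τ)) * (z i * y j) := by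
        simp only [W, of_apply, if_neg hij]
        exact div_mul_cancel₀ _ (mul_ne_zero hp (hdd i j hij))
      linear_combination hW + W i j * ((j : ℂ) + 1) * hq

/-- The clock and shift matrices: `VU = ζ UV` for a primitive root of unity `ζ`. -/
theorem exists_units_mul_eq_smul {n : ℕ} (hn : n ≠ 0) :
    ∃ (U V : (Matrix (Fin (n + 1)) (Fin (n + 1)) ℂ)ˣ) (ζ : ℂ), ζ ≠ 1 ∧
      V.1 * U.1 = ζ • (U.1 * V.1) := by
  obtain ⟨ζ, hζ⟩ : ∃ ζ : ℂ, IsPrimitiveRoot ζ (n + 1) :=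
    ⟨_, Complex.isPrimitiveRoot_exp (n + 1) n.succ_ne_zero⟩
  have h0 : ζ ≠ 0 := hζ.ne_zero n.succ_ne_zero
  let U := diagonal fun i : Fin (n + 1) => ζ ^ (i : ℕ)
  let V := (finRotate (n + 1)).permMatrix ℂ
  have hU : IsUnit U := by
    rw [isUnit_iff_isUnit_det, det_diagonal, isUnit_iff_ne_zero]
    exact Finset.prod_ne_zero_iff.2 fun i _ => pow_ne_zero _ h0
  have hV : IsUnit V := by
    rw [isUnit_iff_isUnit_det, det_permutation]
    exact (Equiv.Perm.sign (finRotate (n + 1))).isUnit.map (Int.castRingHom ℂ)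
  refine ⟨hU.unit, hV.unit, ζ, hζ.ne_one (by omega), ?_⟩
  change V * U = ζ • (U * V)
  ext i j
  have hi : ζ ^ ((finRotate (n + 1) i : Fin (n + 1)) : ℕ) = ζ * ζ ^ (i : ℕ) := by
    rw [coe_finRotate, ← pow_succ']
    split_ifs with hi
    · rw [hi, Fin.val_last, hζ.pow_eq_one, pow_zero]
    · rfl
  have hV' (k : Fin (n + 1)) : V i k = if finRotate (n + 1) i = k then 1 else 0 := by
    simp only [V, Equiv.Perm.permMatrix, PEquiv.toMatrix_apply, Equiv.toPEquiv_apply,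
      Option.mem_def, Option.some_inj]
  rw [Matrix.smul_apply, mul_diagonal, diagonal_mul, hV']
  split_ifs with hij
  · rw [← hij, hi, one_mul, mul_one, smul_eq_mul]
  · simp

/-- Scalar matrices are values: with `VU = ζ UV`, the triple `(U, V, (UV)⁻¹)` has the scalar value
`(p₁ + p₃ + q₂) + ζ (p₂ + q₁ + q₃)`. -/
theorem exists_cubicValue_eq_smul_one {n : ℕ} (hn : n ≠ 0) {p₁ p₂ p₃ q₁ q₂ q₃ : ℂ}
    (hsum : p₁ + p₂ + p₃ + q₁ + q₂ + q₃ = 0) (hc : p₁ + p₃ + q₂ ≠ 0) (t : ℂ) :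
    ∃ X Y Z : Matrix (Fin (n + 1)) (Fin (n + 1)) ℂ,
      cubicValue p₁ p₂ p₃ q₁ q₂ q₃ X Y Z = t • 1 := by
  obtain ⟨U, V, ζ, hζ, h⟩ := exists_units_mul_eq_smul hn
  have e1 : U.1 * V.1 * (V⁻¹.1 * U⁻¹.1) = 1 := by simp [mul_assoc]
  have e2 : V.1 * U.1 * (V⁻¹.1 * U⁻¹.1) = ζ • 1 := by rw [h, smul_mul_assoc, e1]
  have e3 : V.1 * (V⁻¹.1 * U⁻¹.1) * U.1 = 1 := by simp
  have e4 : V⁻¹.1 * U⁻¹.1 * U.1 * V.1 = 1 := by simp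
  have e5 : V⁻¹.1 * U⁻¹.1 * V.1 * U.1 = ζ • 1 := by
    rw [mul_assoc (V⁻¹.1 * U⁻¹.1), h, mul_smul_comm, ← mul_assoc, e4]
  have e6 : U.1 * (V⁻¹.1 * U⁻¹.1) * V.1 = ζ • 1 := by
    have : U.1 * (V⁻¹.1 * U⁻¹.1 * V.1 * U.1) * U⁻¹.1 = ζ • 1 := by rw [e5]; simp
    rw [← this]
    simp [mul_assoc]
  have hne : (p₁ + p₃ + q₂) * (1 - ζ) ≠ 0 := mul_ne_zero hc (sub_ne_zero.2 hζ.symm)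
  refine ⟨U.1, V.1, (t / ((p₁ + p₃ + q₂) * (1 - ζ))) • (V⁻¹.1 * U⁻¹.1), ?_⟩
  simp only [cubicValue, mul_smul_comm, smul_mul_assoc, e1, e2, e3, e4, e5, e6, smul_smul,
    ← add_smul]
  congr 1
  have ht := div_mul_cancel₀ t hne
  linear_combination ht + t / ((p₁ + p₃ + q₂) * (1 - ζ)) * ζ * hsum

/-- Every matrix is a value of `f` if the coefficients of `f` sum to zero, `f(1, Y, Z)` is a nonzero
multiple of `[Y, Z]` (`hp`), and the trace of `f` does not vanish identically (`hc`). -/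
theorem exists_cubicValue_eq {n : ℕ} (hn : n ≠ 0) {p₁ p₂ p₃ q₁ q₂ q₃ : ℂ}
    (hsum : p₁ + p₂ + p₃ + q₁ + q₂ + q₃ = 0) (hp : p₁ + p₂ + p₃ ≠ 0) (hc : p₁ + p₃ + q₂ ≠ 0)
    (A : Matrix (Fin (n + 1)) (Fin (n + 1)) ℂ) :
    ∃ X Y Z, cubicValue p₁ p₂ p₃ q₁ q₂ q₃ X Y Z = A := by
  by_cases hA : ∃ t : ℂ, A = t • 1
  · obtain ⟨t, rfl⟩ := hA
    exact exists_cubicValue_eq_smul_one hn hsum hc t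
  push Not at hA
  have hq : q₁ + q₂ + q₃ ≠ 0 := fun h => hp (by linear_combination hsum - h)
  -- `τ` is nonzero and makes the coefficients of the triangular system nonzero
  obtain ⟨τ, hτ⟩ := Infinite.exists_notMem_finset
    ({0, -(p₁ + p₂ + p₃) / p₃, -(q₁ + q₂ + q₃) / q₁} : Finset ℂ)
  simp only [Finset.mem_insert, Finset.mem_singleton, not_or] at hτ
  obtain ⟨hτ0, hτ1, hτ2⟩ := hτ
  have key {s t : ℂ} (hs : s ≠ 0) (h : τ ≠ -s / t) : s + t * τ ≠ 0 := by
    intro h'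
    have ht : t ≠ 0 := by
      rintro rfl
      simp [hs] at h'
    exact h (by rw [eq_div_iff ht]; linear_combination h')
  have hcτ : (p₁ + p₃ + q₂) * τ ≠ 0 := mul_ne_zero hc hτ0
  set m := A.trace / ((p₁ + p₃ + q₂) * τ)
  obtain ⟨B, ρ, ⟨P, hP⟩, h00, h1, hd⟩ := exists_isConj_diag_eq_mul hA
    (a := ((p₁ + p₃) * (1 + τ) + p₂) * m) (b := (q₁ + q₃ + q₂ * (1 + τ)) * m) (by
      have : (p₁ + p₃ + q₂) * τ * m = A.trace := mul_div_cancel₀ _ hcτ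
      linear_combination this + hsum * m)
  obtain ⟨X, Y, Z, h⟩ := exists_cubicValue_eq_of_diag hsum hp (key hp hτ1) (key hq hτ2) B
    (fun j => m * ρ j)
    (by
      have hr : ∑ j, B j.succ 0 * (m * ρ j) = m := by
        simp_rw [mul_left_comm _ m]
        rw [← Finset.mul_sum, h1, mul_one]
      rw [h00, hr])
    (fun j => by rw [hd]; ring)
  refine ⟨_, _, _, (cubicValue_conj p₁ p₂ p₃ q₁ q₂ q₃ P X Y Z).trans ?_⟩
  rw [h, mul_assoc, ← hP.eq, ← mul_assoc, Units.inv_mul, one_mul]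

/-! ### Polynomials in the free algebra -/

theorem sum_perm_fin_three {M : Type*} [AddCommMonoid M] (g : Equiv.Perm (Fin 3) → M) :
    ∑ σ, g σ = g 1 + g (Equiv.swap 0 1) + g (finRotate 3) + g (Equiv.swap 1 2) +
      g (finRotate 3)⁻¹ + g (Equiv.swap 0 2) := by
  have h : (Finset.univ : Finset (Equiv.Perm (Fin 3))) =
      {1, Equiv.swap 0 1, finRotate 3, Equiv.swap 1 2, (finRotate 3)⁻¹, Equiv.swap 0 2} := by
    decide
  rw [h, Finset.sum_insert (by decide), Finset.sum_insert (by decide),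
    Finset.sum_insert (by decide), Finset.sum_insert (by decide), Finset.sum_insert (by decide),
    Finset.sum_singleton]
  simp only [add_assoc]

theorem lift_multilinearPoly {R : Type*} [Ring R] [Algebra ℂ R] (a : Equiv.Perm (Fin 3) → ℂ)
    (X : Fin 3 → R) :
    FreeAlgebra.lift ℂ X (multilinearPoly a) =
      cubicValue (a 1) (a (Equiv.swap 0 1)) (a (finRotate 3)) (a (Equiv.swap 1 2))
        (a (finRotate 3)⁻¹) (a (Equiv.swap 0 2)) (X 0) (X 1) (X 2) := by
  have r0 : finRotate 3 0 = 1 := by decide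
  have r1 : finRotate 3 1 = 2 := by decide
  have r2 : finRotate 3 2 = 0 := by decide
  have s0 : (finRotate 3)⁻¹ 0 = 2 := by decide
  have s1 : (finRotate 3)⁻¹ 1 = 0 := by decide
  have s2 : (finRotate 3)⁻¹ 2 = 1 := by decide
  have t1 : Equiv.swap (0 : Fin 3) 1 2 = 2 := by decide
  have t2 : Equiv.swap (1 : Fin 3) 2 0 = 0 := by decide
  have t3 : Equiv.swap (0 : Fin 3) 2 1 = 1 := by decide
  simp only [multilinearPoly, sum_perm_fin_three, map_add, map_smul, map_mul,
    FreeAlgebra.lift_ι_apply, cubicValue, r0, r1, r2, s0, s1, s2, t1, t2, t3, Equiv.swap_apply_left,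
    Equiv.swap_apply_right, Equiv.Perm.one_apply]

/-- A polynomial with coefficient sum zero and nonzero cyclic sum is surjective on matrices of any
size at least two. -/
theorem matrixImage_eq_univ {n : ℕ} (hn : n ≠ 0) {a : Equiv.Perm (Fin 3) → ℂ}
    (hs : coeffSum a = 0) (hc : cyclicCoeffSum a ≠ 0) :
    matrixImage (n + 1) (multilinearPoly a) = Set.univ := by
  rw [coeffSum, sum_perm_fin_three] at hs
  rw [cyclicCoeffSum] at hc
  refine Set.eq_univ_of_forall fun A => ?_
  suffices h : ∃ X Y Z, cubicValue (a 1) (a (Equiv.swap 0 1)) (a (finRotate 3))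
      (a (Equiv.swap 1 2)) (a (finRotate 3)⁻¹) (a (Equiv.swap 0 2)) X Y Z = A by
    obtain ⟨X, Y, Z, h⟩ := h
    exact ⟨![X, Y, Z], (lift_multilinearPoly a _).trans h⟩
  by_cases h1 : a 1 + a (Equiv.swap 0 1) + a (finRotate 3) = 0
  · by_cases h2 : a (Equiv.swap 0 1) + a 1 + a (Equiv.swap 1 2) = 0
    · -- the three sums over monomials with two variables in a given order have alternating
      -- sum `cyclicCoeffSum a`
      obtain ⟨Z, X, Y, h⟩ := exists_cubicValue_eq hn (p₁ := a (finRotate 3)⁻¹)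
        (p₂ := a (Equiv.swap 1 2)) (p₃ := a 1) (q₁ := a (Equiv.swap 0 2))
        (q₂ := a (finRotate 3)) (q₃ := a (Equiv.swap 0 1)) (by linear_combination hs)
        (fun h3 => hc (by linear_combination h1 - h2 + h3))
        (fun h => hc (by linear_combination h)) A
      exact ⟨X, Y, Z, by rw [← h, cubicValue, cubicValue]; abel⟩
    · obtain ⟨Y, X, Z, h⟩ := exists_cubicValue_eq hn (p₁ := a (Equiv.swap 0 1)) (p₂ := a 1)
        (p₃ := a (Equiv.swap 1 2)) (q₁ := a (finRotate 3)) (q₂ := a (Equiv.swap 0 2))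
        (q₃ := a (finRotate 3)⁻¹) (by linear_combination hs) h2
        (fun h => hc (by linear_combination hs - h)) A
      exact ⟨X, Y, Z, by rw [← h, cubicValue, cubicValue]; abel⟩
  · exact exists_cubicValue_eq hn hs h1 (fun h => hc (by linear_combination h)) A

/-- If the coefficients of `f` have a nonzero sum `s`, then `f(1, 1, s⁻¹ A) = A`. -/
theorem matrixImage_eq_univ_of_coeffSum_ne_zero (d : ℕ) {a : Equiv.Perm (Fin 3) → ℂ}
    (hs : coeffSum a ≠ 0) : matrixImage d (multilinearPoly a) = Set.univ := by
  refine Set.eq_univ_of_forall fun A => ⟨![1, 1, (coeffSum a)⁻¹ • A], ?_⟩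
  refine (lift_multilinearPoly a _).trans ?_
  simp only [cubicValue, Matrix.cons_val, one_mul, mul_one, ← add_smul]
  rw [← sum_perm_fin_three, ← coeffSum, smul_inv_smul₀ hs]

theorem isSumOfCommutators_multilinearPoly {a : Equiv.Perm (Fin 3) → ℂ} (hs : coeffSum a = 0)
    (hc : cyclicCoeffSum a = 0) : IsSumOfCommutators (multilinearPoly a) := by
  rw [coeffSum, sum_perm_fin_three] at hs
  rw [cyclicCoeffSum] at hc
  have hmem (p q : FreeAlgebra ℂ (Fin 3)) :
      p * q - q * p ∈ AddSubmonoid.closure {g | ∃ p q, g = p * q - q * p} :=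
    AddSubmonoid.subset_closure ⟨p, q, rfl⟩
  let x := FreeAlgebra.ι ℂ (X := Fin 3)
  have h := lift_multilinearPoly a x
  have hx : FreeAlgebra.lift ℂ x = AlgHom.id ℂ _ := FreeAlgebra.hom_ext (by ext; simp [x])
  rw [hx, AlgHom.id_apply] at h
  -- monomials that are cyclic rotations of each other differ by a commutator
  have h' : multilinearPoly a =
      (((a (finRotate 3) • (x 1 * x 2)) * x 0 - x 0 * (a (finRotate 3) • (x 1 * x 2))) +
        ((a (finRotate 3)⁻¹ • x 2) * (x 0 * x 1) - (x 0 * x 1) * (a (finRotate 3)⁻¹ • x 2))) +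
      (((a (Equiv.swap 1 2) • (x 0 * x 2)) * x 1 - x 1 * (a (Equiv.swap 1 2) • (x 0 * x 2))) +
        ((a (Equiv.swap 0 2) • x 2) * (x 1 * x 0) - (x 1 * x 0) * (a (Equiv.swap 0 2) • x 2))) := by
    have e1 : a 1 = -(a (finRotate 3) + a (finRotate 3)⁻¹) := by linear_combination hc
    have e2 : a (Equiv.swap 0 1) = -(a (Equiv.swap 1 2) + a (Equiv.swap 0 2)) := by
      linear_combination hs - hc
    rw [h, e1, e2, cubicValue]
    simp only [smul_mul_assoc, mul_smul_comm, neg_smul, add_smul, mul_assoc]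
    abel
  rw [IsSumOfCommutators, h']
  exact add_mem (add_mem (hmem _ _) (hmem _ _)) (add_mem (hmem _ _) (hmem _ _))

theorem proposition3p8 (d : ℕ)
    (hd : (Odd d ∧ 5 ≤ d ∧ d ≤ 15) ∨ d = 21 ∨ d = 35)
    (a : Equiv.Perm (Fin 3) → ℂ) :
    (coeffSum a = 0 → cyclicCoeffSum a ≠ 0 →
      matrixImage d (multilinearPoly a) = Set.univ) ∧
    (¬ IsSumOfCommutators (multilinearPoly a) →
      matrixImage d (multilinearPoly a) = Set.univ) := by
  obtain ⟨n, hn, rfl⟩ : ∃ n, n ≠ 0 ∧ d = n + 1 := ⟨d - 1, by omega, by omega⟩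
  refine ⟨matrixImage_eq_univ hn, fun hf => ?_⟩
  by_cases hs : coeffSum a = 0
  · exact matrixImage_eq_univ hn hs fun hc => hf (isSumOfCommutators_multilinearPoly hs hc)
  · exact matrixImage_eq_univ_of_coeffSum_ne_zero _ hs
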